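/- Let $\mathcal H=\mathbb C^d$, let $\mathcal P$ be a self-inverse unitary ($\mathcal P=\mathcal P^\dagger$, $\mathcal P^2=I$), and let $\mathcal T=U\mathcal K$ be a time reversal operator, where $\mathcal K$ is complex conjugation in the standard basis and $U$ is a unitary matrix with $U=U^t$, such that $[\mathcal P,\mathcal T]=0$. A state is a positive semidefinite matrix $\rho$ with $\mathrm{Tr}\,\rho=1$; a quantum operation is a map $\Phi(X)=\sum_\mu K_\mu XK_\mu^\dagger$ with finitely many Kraus operators $K_\mu$ on $\mathcal H$ satisfying $\sum_\mu K_\mu^\dagger K_\mu=I$. For a state $\rho$ put $$\Gamma_s(\rho,\mathcal{PT})=-\tfrac12\mathrm{Tr}\,[\rho^{1/2},\mathcal{PT}]^2=1-\mathrm{Tr}\,\rho^{1/2}\mathcal{PT}\rho^{1/2}\mathcal{PT}$$ (the two expressions agree and are real). Then $\Gamma_s$ is a proper $\mathcal{PT}$-asymmetry measure, that is: (C1) for every state $\rho$, $\Gamma_s(\rho,\mathcal{PT})=0$ if and only if $[\rho,\mathcal{PT}]=0$; (C2) if $\Phi$ is a quantum operation with $\Phi(\mathcal{PT}\rho\,\mathcal{PT})=\mathcal{PT}\,\Phi(\rho)\,\mathcal{PT}$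 for all states $\rho$, then $\Gamma_s(\Phi(\rho),\mathcal{PT})\le\Gamma_s(\rho,\mathcal{PT})$ for every state $\rho$; (C2') if $K_\mu$ are the finitely many Kraus operators of a quantum operation ($\sum_\mu K_\mu^\dagger K_\mu=I$) and $K_\mu\,\mathcal{PT}\rho\,\mathcal{PT}K_\mu^\dagger=\mathcal{PT}K_\mu\rho K_\mu^\dagger\mathcal{PT}$ for all $\mu$ and all states $\rho$, then $\sum_\mu p_\mu\Gamma_s(\rho_\mu,\mathcal{PT})\le\Gamma_s(\rho,\mathcal{PT})$ for every state $\rho$, where $p_\mu=\mathrm{Tr}\,K_\mu\rho K_\mu^\dagger$, $\rho_\mu=K_\mu\rho K_\mu^\dagger/p_\mu$, and terms with $p_\mu=0$ count as $0$; (C3) for finitely many states $\rho_k$ and $p_k\ge0$ with $\sum_kp_k=1$, $\Gamma_s(\sum_kp_k\rho_k,\mathcal{PT})\le\sum_kp_k\Gamma_s(\rho_k,\mathcal{PT})$. Moreover, for every state $\rho$, $\Gamma_s(\rho,\mathcal{PT})\ge1-F(\rho,\mathcal{PT}\rho\,\mathcal{PT})$, where $F(\rho_1,\rho_2)=\mathrm{Tr}\,|\rho_1^{1/2}\rho_2^{1/2}|$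 and $|A|=(A^\dagger A)^{1/2}$; likewise $\Gamma_F(\rho,\mathcal{PT})\le\Gamma_s(\rho,\mathcal{PT})$, where $\Gamma_F(\rho,\mathcal{PT})=1-\mathrm{Tr}\sqrt{\sqrt\rho\,\mathcal{PT}\rho\,\mathcal{PT}\sqrt\rho}$. -/

import Mathlib

open scoped Matrix ComplexOrder MatrixOrder ComplexConjugate

noncomputable section

namespace PTAsymmetry

variable {n : Type*} [Fintype n] [DecidableEq n]

/-- A density matrix (quantum state) on `ℂⁿ`. -/
def IsState (ρ : Matrix n n ℂ) : Prop :=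
  ρ.PosSemidef ∧ ρ.trace = 1

/-- Complex conjugation `𝒦` in the standard basis, as an antilinear operator on `ℂⁿ`. -/
def conjOp (n : Type*) : (n → ℂ) →ₛₗ[starRingEnd ℂ] (n → ℂ) where
  toFun v := fun i => conj (v i)
  map_add' v w := by ext i; simp
  map_smul' c v := by ext i; simp

/-- The antilinear operator `U𝒦`. -/
def unitaryConj (U : Matrix n n ℂ) : (n → ℂ) →ₛₗ[starRingEnd ℂ] (n → ℂ) :=
  (Matrix.toLin' U).comp (conjOp n)

/-- A self-inverse unitary `𝒫` together with a time reversal operator `𝒯 = U𝒦`, where `U` is a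
symmetric unitary matrix, such that `𝒫` and `𝒯` commute. -/
structure PTPair (n : Type*) [Fintype n] [DecidableEq n] where
  P : Matrix n n ℂ
  U : Matrix n n ℂ
  P_isHermitian : P.IsHermitian
  P_sq : P * P = 1
  U_unitary : U ∈ Matrix.unitaryGroup n ℂ
  U_symm : Uᵀ = U
  comm : (Matrix.toLin' P).comp (unitaryConj U) = (unitaryConj U).comp (Matrix.toLin' P)

namespace PTPair

/-- The time reversal operator `𝒯 = U𝒦`. -/
def T (M : PTPair n) : (n → ℂ) →ₛₗ[starRingEnd ℂ] (n → ℂ) :=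
  unitaryConj M.U

/-- The antilinear operator `𝒫𝒯`. -/
def PT (M : PTPair n) : (n → ℂ) →ₛₗ[starRingEnd ℂ] (n → ℂ) :=
  (Matrix.toLin' M.P).comp M.T

/-- The matrix of the (linear) operator `𝒫𝒯 X 𝒫𝒯`. -/
def conjugate (M : PTPair n) (X : Matrix n n ℂ) : Matrix n n ℂ :=
  LinearMap.toMatrix' ((M.PT.comp (Matrix.toLin' X)).comp M.PT : (n → ℂ) →ₗ[ℂ] (n → ℂ))

/-- The commutator `[X, 𝒫𝒯]`, an antilinear operator. -/
def commutator (M : PTPair n) (X : Matrix n n ℂ) : (n → ℂ) →ₛₗ[starRingEnd ℂ] (n → ℂ) :=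
  (Matrix.toLin' X).comp M.PT - M.PT.comp (Matrix.toLin' X)

/-- The matrix of the (linear) operator `[X, 𝒫𝒯]²`. -/
def commutatorSq (M : PTPair n) (X : Matrix n n ℂ) : Matrix n n ℂ :=
  LinearMap.toMatrix' ((M.commutator X).comp (M.commutator X) : (n → ℂ) →ₗ[ℂ] (n → ℂ))

end PTPair

/-- `K` is a (finite) family of Kraus operators of a trace-preserving quantum operation. -/
def IsKraus {m : ℕ} (K : Fin m → Matrix n n ℂ) : Prop :=
  ∑ μ, (K μ)ᴴ * K μ = 1

/-- A quantum operation: `Φ(X) = ∑ μ, K μ X (K μ)ᴴ` for a family of Kraus operators. -/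
def IsQuantumOperation (Φ : Matrix n n ℂ → Matrix n n ℂ) : Prop :=
  ∃ (m : ℕ) (K : Fin m → Matrix n n ℂ), IsKraus K ∧ ∀ X, Φ X = ∑ μ, K μ * X * (K μ)ᴴ

/-- `Φ` is `𝒫𝒯`-covariant: `Φ(𝒫𝒯 ρ 𝒫𝒯) = 𝒫𝒯 Φ(ρ) 𝒫𝒯` for all states `ρ`. -/
def IsCovariant (M : PTPair n) (Φ : Matrix n n ℂ → Matrix n n ℂ) : Prop :=
  ∀ ρ, IsState ρ → Φ (M.conjugate ρ) = M.conjugate (Φ ρ)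

/-- The probability `p_μ = Tr (K_μ ρ K_μ†)` of an outcome. -/
def outcomeProb (K ρ : Matrix n n ℂ) : ℝ :=
  (K * ρ * Kᴴ).trace.re

/-- The state `ρ_μ = K_μ ρ K_μ† / p_μ` after an outcome (the zero matrix if `p_μ = 0`; such an
outcome carries the weight `p_μ = 0`). -/
def outcomeState (K ρ : Matrix n n ℂ) : Matrix n n ℂ :=
  ((outcomeProb K ρ)⁻¹ : ℂ) • (K * ρ * Kᴴ)

/-- The conditions on a proper `𝒫𝒯`-asymmetry measure `Γ` (only its values on states matter). -/
structure IsProperMeasure (M : PTPair n) (Γ : Matrix n n ℂ → ℝ) : Prop where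
  /-- (C1) -/
  faithful : ∀ ρ, IsState ρ → (Γ ρ = 0 ↔ M.commutator ρ = 0)
  /-- (C2) -/
  monotone : ∀ Φ, IsQuantumOperation Φ → IsCovariant M Φ → ∀ ρ, IsState ρ → Γ (Φ ρ) ≤ Γ ρ
  /-- (C2') -/
  selective_monotone : ∀ (m : ℕ) (K : Fin m → Matrix n n ℂ), IsKraus K →
    (∀ μ, IsCovariant M (fun X => K μ * X * (K μ)ᴴ)) →
    ∀ ρ, IsState ρ → ∑ μ, outcomeProb (K μ) ρ * Γ (outcomeState (K μ) ρ) ≤ Γ ρ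
  /-- (C3) -/
  convex : ∀ (m : ℕ) (p : Fin m → ℝ) (ρ : Fin m → Matrix n n ℂ),
    (∀ k, 0 ≤ p k) → ∑ k, p k = 1 → (∀ k, IsState (ρ k)) →
    Γ (∑ k, (p k : ℂ) • ρ k) ≤ ∑ k, p k * Γ (ρ k)

/-- The skew information of `𝒫𝒯`-asymmetry, `Γ_s(ρ) = 1 - Tr (ρ^{1/2} 𝒫𝒯 ρ^{1/2} 𝒫𝒯)`. -/
def gammaS (M : PTPair n) (ρ : Matrix n n ℂ) : ℝ :=
  1 - (CFC.sqrt ρ * M.conjugate (CFC.sqrt ρ)).trace.re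

/-- The fidelity `F(ρ, σ) = Tr |ρ^{1/2} σ^{1/2}|`, where `|A| = (A†A)^{1/2}`. -/
def fidelity (ρ σ : Matrix n n ℂ) : ℝ :=
  (CFC.sqrt ((CFC.sqrt ρ * CFC.sqrt σ)ᴴ * (CFC.sqrt ρ * CFC.sqrt σ))).trace.re

/-- The fidelity measure `Γ_F(ρ) = 1 - Tr √(√ρ 𝒫𝒯 ρ 𝒫𝒯 √ρ)`. -/
def gammaF (M : PTPair n) (ρ : Matrix n n ℂ) : ℝ :=
  1 - (CFC.sqrt (CFC.sqrt ρ * M.conjugate ρ * CFC.sqrt ρ)).trace.re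

end PTAsymmetry

end

/-! Write `𝒫𝒯 = W𝒦`. Since `(𝒫𝒯)² = 1`, the map `J X = 𝒫𝒯 X 𝒫𝒯` equals `W X̄ Wᴴ`: it is antilinear,
multiplicative and positive, so it commutes with square roots, and `Γ_s(ρ) = 1 - A(ρ, Jρ)` with the
affinity `A(ρ, σ) = Tr ρ^{1/2} σ^{1/2}`.

Everything but (C1) and the fidelity bounds reduces to monotonicity of `A` under channels,
`affinity_le_affinity_kraus`. On matrices with the Hilbert-Schmidt product, left multiplication by
`√ρ` commutes with right multiplication by `√σ`, and their product sends `1` to `√ρ √σ`. A Schwarz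
inequality for the unital dual channel compares the squares of these operators before and after the
channel; `compress_mul_le` transfers the comparison to their product, and pairing with the identity
matrix gives the claim.

Block-diagonal states then yield joint concavity and selective monotonicity. (C1) is the equality
case of `‖√ρ - J√ρ‖² ≥ 0`, and the fidelity bounds follow from `Re Tr Q ≤ Tr |Q|`. -/

noncomputable section

namespace PTAsymmetry

open Matrix Kronecker

/-! ### Matrix inequalities: square roots, compressions, traces -/

section Sqrt

variable {n : Type*} [Fintype n] [DecidableEq n]

open scoped Matrix.Norms.L2Operator in
/-- Operator monotonicity of the square root. -/
theorem le_of_mul_self_le_mul_self {A B : Matrix n n ℂ} (hA : A.PosSemidef) (hB : B.PosSemidef)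
    (h : A * A ≤ B * B) : A ≤ B := by
  have hA' : 0 ≤ A := nonneg_iff_posSemidef.2 hA
  have hB' : 0 ≤ B := nonneg_iff_posSemidef.2 hB
  have := CFC.sqrt_le_sqrt _ _ h
  rwa [CFC.sqrt_mul_self A hA', CFC.sqrt_mul_self B hB'] at this

theorem sqrt_posSemidef (A : Matrix n n ℂ) : (CFC.sqrt A).PosSemidef :=
  nonneg_iff_posSemidef.1 (CFC.sqrt_nonneg A)

theorem conjTranspose_sqrt (A : Matrix n n ℂ) : (CFC.sqrt A)ᴴ = CFC.sqrt A :=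
  (sqrt_posSemidef A).isHermitian

theorem sqrt_mul_sqrt {A : Matrix n n ℂ} (hA : A.PosSemidef) : CFC.sqrt A * CFC.sqrt A = A :=
  CFC.sqrt_mul_sqrt_self A (nonneg_iff_posSemidef.2 hA)

theorem sqrt_eq_of_mul_self {A B : Matrix n n ℂ} (h : B * B = A) (hB : B.PosSemidef) :
    CFC.sqrt A = B :=
  CFC.sqrt_unique h (nonneg_iff_posSemidef.2 hB)

/-- Follows from `1 - YYᴴ = Y(1 - YᴴY)Yᴴ + (1 - YYᴴ)ᴴ(1 - YYᴴ)`. -/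
theorem conjTranspose_mul_self_le_one_symm {m : Type*} [Fintype m] [DecidableEq m]
    {Y : Matrix m n ℂ} (h : Yᴴ * Y ≤ 1) : Y * Yᴴ ≤ 1 := by
  rw [le_iff] at h ⊢
  have h1 := (h.mul_mul_conjTranspose_same Y).add
    ((posSemidef_conjTranspose_mul_self (1 - Y * Yᴴ)))
  convert h1 using 1
  simp only [conjTranspose_sub, conjTranspose_one, conjTranspose_mul, conjTranspose_conjTranspose,
    Matrix.mul_sub, Matrix.sub_mul, Matrix.mul_one, Matrix.one_mul, Matrix.mul_assoc]
  abel

/-- For commuting pairs `r, s` and `p, q`, the product (the geometric mean of the squares) is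
superadditive under compressions. -/
theorem compress_mul_le {m : Type*} [Fintype m] [DecidableEq m] {r s : Matrix m m ℂ}
    {p q : Matrix n n ℂ} (C : Matrix m n ℂ) (hr : r.IsHermitian) (hs : s.IsHermitian)
    (hrs : (r * s).PosSemidef) (hp : p.PosDef) (hq : q.IsHermitian) (hpq : (p * q).PosSemidef)
    (h1 : Cᴴ * (r * r) * C ≤ p * p) (h2 : Cᴴ * (s * s) * C ≤ q * q) :
    Cᴴ * (r * s) * C ≤ p * q := by
  have hdet : IsUnit p.det := (isUnit_iff_isUnit_det p).1 hp.isUnit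
  have hpi : p⁻¹ᴴ = p⁻¹ := hp.isHermitian.inv
  have hsr : s * r = r * s := by
    have := hrs.isHermitian.eq
    rwa [conjTranspose_mul, hr.eq, hs.eq] at this
  have hqp : q * p = p * q := by
    have := hpq.isHermitian.eq
    rwa [conjTranspose_mul, hp.isHermitian.eq, hq.eq] at this
  have hpp : p⁻¹ * p = 1 := nonsing_inv_mul p hdet
  have hpp' : p * p⁻¹ = 1 := mul_nonsing_inv p hdet
  have conj_le : ∀ {X Y : Matrix n n ℂ}, X ≤ Y → p⁻¹ * X * p⁻¹ ≤ p⁻¹ * Y * p⁻¹ := by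
    intro X Y h
    have := (le_iff.1 h).conjTranspose_mul_mul_same p⁻¹
    rw [le_iff]
    convert this using 1
    rw [hpi, Matrix.mul_sub, Matrix.sub_mul]
  set Y := r * C * p⁻¹ with hY
  set Z := s * C * p⁻¹ with hZ
  -- Conjugating by `p⁻¹` normalizes the first bound to a contraction `Y`; the compressed product
  -- becomes `YᴴZ = ZᴴY`.
  have hYY : Yᴴ * Y ≤ 1 := by
    have := conj_le h1
    convert this using 1
    · simp only [hY, conjTranspose_mul, hpi, hr.eq, Matrix.mul_assoc]
    · rw [← Matrix.mul_assoc, hpp, Matrix.one_mul, hpp']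
  have hZZ : Zᴴ * Z ≤ (p⁻¹ * q) * (p⁻¹ * q) := by
    have := conj_le h2
    convert this using 1
    · simp only [hZ, conjTranspose_mul, hpi, hs.eq, Matrix.mul_assoc]
    · have : q * p⁻¹ = p⁻¹ * q := by
        calc q * p⁻¹ = p⁻¹ * (p * q) * p⁻¹ := by rw [← Matrix.mul_assoc, hpp, Matrix.one_mul]
          _ = p⁻¹ * q := by rw [← hqp, Matrix.mul_assoc, Matrix.mul_assoc, hpp', Matrix.mul_one]
      simp only [Matrix.mul_assoc, this]
  have hA : p⁻¹ * (Cᴴ * (r * s) * C) * p⁻¹ = Yᴴ * Z := by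
    simp only [hY, hZ, conjTranspose_mul, hpi, hr.eq, Matrix.mul_assoc]
  have hA' : p⁻¹ * (Cᴴ * (r * s) * C) * p⁻¹ = Zᴴ * Y := by
    rw [← hsr]
    simp only [hY, hZ, conjTranspose_mul, hpi, hs.eq, Matrix.mul_assoc]
  have hApos : (p⁻¹ * (Cᴴ * (r * s) * C) * p⁻¹).PosSemidef := by
    have := (hrs.conjTranspose_mul_mul_same C).conjTranspose_mul_mul_same p⁻¹
    rwa [hpi] at this
  have hB : p⁻¹ * q = p⁻¹ * (p * q) * p⁻¹ := by
    rw [← hqp, Matrix.mul_assoc, Matrix.mul_assoc, hpp', Matrix.mul_one]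
  have hBpos : (p⁻¹ * q).PosSemidef := by
    have := hpq.conjTranspose_mul_mul_same p⁻¹
    rwa [hpi, ← hB] at this
  -- With `A = ZᴴY = YᴴZ`: `A² = Zᴴ(YYᴴ)Z ≤ ZᴴZ ≤ (p⁻¹q)²`, and the square root is operator
  -- monotone.
  have key := le_of_mul_self_le_mul_self hApos hBpos (by
    refine le_trans ?_ hZZ
    rw [le_iff]
    have := (le_iff.1 (conjTranspose_mul_self_le_one_symm hYY)).conjTranspose_mul_mul_same Z
    convert this using 1
    rw [Matrix.mul_sub, Matrix.sub_mul, Matrix.mul_one]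
    congr 1
    conv_lhs => rw [hA']
    conv_lhs => enter [2]; rw [← hA', hA]
    simp only [Matrix.mul_assoc])
  have := (le_iff.1 key).conjTranspose_mul_mul_same p
  rw [le_iff]
  convert this using 1
  rw [hp.isHermitian.eq, hB, ← Matrix.sub_mul, ← Matrix.mul_sub]
  calc _ = (p * p⁻¹) * (p * q - Cᴴ * (r * s) * C) * (p⁻¹ * p) := by
        rw [hpp, hpp', Matrix.one_mul, Matrix.mul_one]
    _ = _ := by simp only [Matrix.mul_assoc]

/-- In an eigenbasis of `|Q|` with eigenvalues `d i`, column `i` of `Q` has norm `d i`, which bounds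
its diagonal entry. -/
theorem re_trace_le_trace_abs (Q : Matrix n n ℂ) :
    Q.trace.re ≤ (CFC.sqrt (Qᴴ * Q)).trace.re := by
  set H := CFC.sqrt (Qᴴ * Q) with hHdef
  have hH : H.PosSemidef := sqrt_posSemidef _
  have hHH : H * H = Qᴴ * Q := sqrt_mul_sqrt (posSemidef_conjTranspose_mul_self Q)
  set V : Matrix n n ℂ := hH.isHermitian.eigenvectorUnitary.1 with hV
  have hV1 : Vᴴ * V = 1 := Unitary.coe_star_mul_self hH.isHermitian.eigenvectorUnitary
  have hV2 : V * Vᴴ = 1 := Unitary.coe_mul_star_self hH.isHermitian.eigenvectorUnitary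
  set d := hH.isHermitian.eigenvalues
  have hd : ∀ i, 0 ≤ d i := hH.eigenvalues_nonneg
  have hD : H = V * diagonal (fun i => (d i : ℂ)) * Vᴴ := by
    have := hH.isHermitian.spectral_theorem
    rw [Unitary.conjStarAlgAut_apply] at this
    exact this
  set R := Vᴴ * Q * V with hR
  have hRR : Rᴴ * R = diagonal (fun i => (d i : ℂ)) * diagonal (fun i => (d i : ℂ)) := by
    calc Rᴴ * R = Vᴴ * (Qᴴ * (V * Vᴴ) * Q) * V := by
          simp only [hR, conjTranspose_mul, conjTranspose_conjTranspose, Matrix.mul_assoc]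
      _ = Vᴴ * (H * H) * V := by rw [hV2, Matrix.mul_one, hHH]
      _ = (Vᴴ * V) * diagonal (fun i => (d i : ℂ)) * (Vᴴ * V) * diagonal (fun i => (d i : ℂ))
            * (Vᴴ * V) := by
          rw [hD]; simp only [Matrix.mul_assoc]
      _ = _ := by rw [hV1]; simp
  have htr : Q.trace = R.trace := by
    rw [hR, Matrix.trace_mul_comm, ← Matrix.mul_assoc, hV2, Matrix.one_mul]
  have htrH : H.trace.re = ∑ i, d i := by
    rw [hD, Matrix.trace_mul_comm, ← Matrix.mul_assoc, hV1, Matrix.one_mul]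
    simp [trace_diagonal]
  rw [htr, htrH, trace, Complex.re_sum]
  refine Finset.sum_le_sum fun i _ => ?_
  have h1 : ∑ j, Complex.normSq (R j i) = d i * d i := by
    have := congrArg Complex.re (congrFun (congrFun hRR i) i)
    rw [diagonal_mul_diagonal, diagonal_apply_eq, Matrix.mul_apply, Complex.re_sum] at this
    simpa [Complex.normSq_apply] using this
  have h2 : Complex.normSq (R i i) ≤ d i * d i := by
    rw [← h1]
    exact Finset.single_le_sum (f := fun j => Complex.normSq (R j i))
      (fun j _ => Complex.normSq_nonneg _) (Finset.mem_univ i)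
  have h3 : (R i i).re * (R i i).re ≤ d i * d i := by
    refine le_trans ?_ h2
    rw [Complex.normSq_apply]
    nlinarith [mul_self_nonneg (R i i).im]
  exact (abs_le_of_sq_le_sq' (by rw [pow_two, pow_two]; exact h3) (hd i)).2

end Sqrt

/-! ### Monotonicity of the affinity under channels -/

section Affinity

variable {n k ι : Type*} [Fintype n] [DecidableEq n] [Fintype k] [DecidableEq k] [Fintype ι]

/-- The quantum affinity `Tr (ρ^{1/2} σ^{1/2})`. -/
def affinity (ρ σ : Matrix n n ℂ) : ℝ :=
  (CFC.sqrt ρ * CFC.sqrt σ).trace.re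

-- The stacked column of the `K μ` is an isometry, so its range projection is at most `1`.
-- Concretely, the difference of the two sides is `∑ (Z μ - W (K μ)ᴴ)(Z μ - W (K μ)ᴴ)ᴴ` with `W = ∑
-- Z μ K μ`.
omit [DecidableEq k] in
theorem sum_mul_mul_conjTranspose_le {a : Type*} [Fintype a] (K : ι → Matrix k n ℂ)
    (hK : ∑ μ, (K μ)ᴴ * K μ = 1) (Z : ι → Matrix a k ℂ) :
    (∑ μ, Z μ * K μ) * (∑ μ, Z μ * K μ)ᴴ ≤ ∑ μ, Z μ * (Z μ)ᴴ := by
  set W := ∑ μ, Z μ * K μ with hW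
  have h : (∑ μ, (Z μ - W * (K μ)ᴴ) * (Z μ - W * (K μ)ᴴ)ᴴ).PosSemidef :=
    posSemidef_sum _ fun μ _ => posSemidef_self_mul_conjTranspose _
  have e : ∀ μ, (Z μ - W * (K μ)ᴴ) * (Z μ - W * (K μ)ᴴ)ᴴ =
      Z μ * (Z μ)ᴴ - (Z μ * K μ) * Wᴴ - W * (Z μ * K μ)ᴴ + W * ((K μ)ᴴ * K μ) * Wᴴ := by
    intro μ
    simp only [conjTranspose_sub, conjTranspose_mul, conjTranspose_conjTranspose, Matrix.mul_sub,
      Matrix.sub_mul, Matrix.mul_assoc]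
    abel
  have e' : ∑ μ, (Z μ - W * (K μ)ᴴ) * (Z μ - W * (K μ)ᴴ)ᴴ = ∑ μ, Z μ * (Z μ)ᴴ - W * Wᴴ := by
    rw [Finset.sum_congr rfl fun μ _ => e μ, Finset.sum_add_distrib, Finset.sum_sub_distrib,
      Finset.sum_sub_distrib, ← Matrix.sum_mul, ← Matrix.mul_sum, ← conjTranspose_sum,
      ← Matrix.sum_mul, ← Matrix.mul_sum, hK, ← hW, Matrix.mul_one, sub_add_cancel]
  rwa [le_iff, ← e']

omit [DecidableEq n] in
theorem conjTranspose_mul_self_le_of_forall {a b : Type*} [Fintype a] [Fintype b]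
    {A : Matrix a n ℂ} {B : Matrix b n ℂ}
    (h : ∀ v, star (A *ᵥ v) ⬝ᵥ (A *ᵥ v) ≤ star (B *ᵥ v) ⬝ᵥ (B *ᵥ v)) : Aᴴ * A ≤ Bᴴ * B := by
  rw [le_iff]
  refine PosSemidef.of_dotProduct_mulVec_nonneg
    ((isHermitian_conjTranspose_mul_self B).sub (isHermitian_conjTranspose_mul_self A)) fun v => ?_
  have := sub_nonneg.2 (h v)
  rw [sub_mulVec, dotProduct_sub, ← mulVec_mulVec, ← mulVec_mulVec, dotProduct_mulVec _ Bᴴ,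
    dotProduct_mulVec _ Aᴴ, ← star_mulVec, ← star_mulVec]
  exact this

omit [DecidableEq n] in
theorem trace_le_trace {A B : Matrix n n ℂ} (h : A ≤ B) : A.trace ≤ B.trace := by
  have := (le_iff.1 h).trace_nonneg
  rwa [trace_sub, sub_nonneg] at this

/-- The dual `Y ↦ ∑ μ, (K μ)ᴴ * Y * K μ` of a quantum channel, acting on vectorized matrices. -/
def dualChannel (K : ι → Matrix k n ℂ) : Matrix (n × n) (k × k) ℂ :=
  ∑ μ, (K μ)ᵀ ⊗ₖ (K μ)ᴴ

omit [Fintype n] [DecidableEq n] [DecidableEq k] in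
theorem dualChannel_mulVec_vec (K : ι → Matrix k n ℂ) (Y : Matrix k k ℂ) :
    dualChannel K *ᵥ vec Y = vec (∑ μ, (K μ)ᴴ * Y * K μ) := by
  simp only [dualChannel, sum_mulVec, kronecker_mulVec_vec, vec_sum, transpose_transpose]

/-- Tested on `vec Y`, this is the Schwarz inequality `Tr ρ Φ*(Y) Φ*(Y)ᴴ ≤ Tr Φ(ρ) Y Yᴴ`. -/
theorem dualChannel_left_le (K : ι → Matrix k n ℂ) (hK : ∑ μ, (K μ)ᴴ * K μ = 1)
    {ρ : Matrix n n ℂ} (hρ : ρ.PosSemidef) {p : Matrix k k ℂ} (hp : p.IsHermitian)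
    (hpp : p * p = ∑ μ, K μ * ρ * (K μ)ᴴ) :
    (dualChannel K)ᴴ * (((1 : Matrix n n ℂ) ⊗ₖ CFC.sqrt ρ) * (1 ⊗ₖ CFC.sqrt ρ)) * dualChannel K ≤
      ((1 : Matrix k k ℂ) ⊗ₖ p) * (1 ⊗ₖ p) := by
  have key : (((1 : Matrix n n ℂ) ⊗ₖ CFC.sqrt ρ) * dualChannel K)ᴴ * (((1 : Matrix n n ℂ) ⊗ₖ CFC.sqrt ρ) * dualChannel K) ≤
      ((1 : Matrix k k ℂ) ⊗ₖ p)ᴴ * (1 ⊗ₖ p) := by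
    refine conjTranspose_mul_self_le_of_forall fun v => ?_
    obtain ⟨Y, rfl⟩ := vec_bijective.surjective v
    rw [← mulVec_mulVec, dualChannel_mulVec_vec, kronecker_mulVec_vec, kronecker_mulVec_vec,
      star_vec_dotProduct_vec, star_vec_dotProduct_vec, transpose_one, Matrix.mul_one,
      transpose_one, Matrix.mul_one]
    have h := trace_le_trace
      (sum_mul_mul_conjTranspose_le K hK fun μ => CFC.sqrt ρ * (K μ)ᴴ * Y)
    have e : ∑ μ, CFC.sqrt ρ * (K μ)ᴴ * Y * K μ = CFC.sqrt ρ * ∑ μ, (K μ)ᴴ * Y * K μ := by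
      simp only [Matrix.mul_sum, Matrix.mul_assoc]
    rw [e, trace_mul_comm] at h
    refine h.trans_eq ?_
    calc _ = ∑ μ, (Yᴴ * (K μ * (CFC.sqrt ρ * CFC.sqrt ρ) * (K μ)ᴴ) * Y).trace := by
          rw [trace_sum]
          refine Finset.sum_congr rfl fun μ _ => ?_
          rw [trace_mul_comm]
          simp only [conjTranspose_mul, conjTranspose_conjTranspose, conjTranspose_sqrt,
            Matrix.mul_assoc]
      _ = (Yᴴ * (p * p) * Y).trace := by
          rw [← trace_sum, hpp, sqrt_mul_sqrt hρ, Matrix.mul_sum, Matrix.sum_mul]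
      _ = _ := by rw [conjTranspose_mul, hp.eq]; simp only [Matrix.mul_assoc]
  simpa only [conjTranspose_mul, conjTranspose_kronecker, conjTranspose_one, hp.eq,
    conjTranspose_sqrt, Matrix.mul_assoc] using key

/-- The mirror image for right multiplication: the same Schwarz inequality applied to `Yᴴ`. -/
theorem dualChannel_right_le (K : ι → Matrix k n ℂ) (hK : ∑ μ, (K μ)ᴴ * K μ = 1)
    {σ : Matrix n n ℂ} (hσ : σ.PosSemidef) {q : Matrix k k ℂ} (hq : q.IsHermitian)
    (hqq : q * q = ∑ μ, K μ * σ * (K μ)ᴴ) :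
    (dualChannel K)ᴴ * (((CFC.sqrt σ)ᵀ ⊗ₖ (1 : Matrix n n ℂ)) * ((CFC.sqrt σ)ᵀ ⊗ₖ (1 : Matrix n n ℂ))) * dualChannel K ≤
      (qᵀ ⊗ₖ (1 : Matrix k k ℂ)) * (qᵀ ⊗ₖ 1) := by
  have key : (((CFC.sqrt σ)ᵀ ⊗ₖ (1 : Matrix n n ℂ)) * dualChannel K)ᴴ * (((CFC.sqrt σ)ᵀ ⊗ₖ (1 : Matrix n n ℂ)) * dualChannel K) ≤
      (qᵀ ⊗ₖ (1 : Matrix k k ℂ))ᴴ * (qᵀ ⊗ₖ 1) := by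
    refine conjTranspose_mul_self_le_of_forall fun v => ?_
    obtain ⟨Y, rfl⟩ := vec_bijective.surjective v
    rw [← mulVec_mulVec, dualChannel_mulVec_vec, kronecker_mulVec_vec, kronecker_mulVec_vec,
      star_vec_dotProduct_vec, star_vec_dotProduct_vec, transpose_transpose, Matrix.one_mul,
      transpose_transpose, Matrix.one_mul]
    have h := trace_le_trace
      (sum_mul_mul_conjTranspose_le K hK fun μ => CFC.sqrt σ * (K μ)ᴴ * Yᴴ)
    have e : ∑ μ, CFC.sqrt σ * (K μ)ᴴ * Yᴴ * K μ = ((∑ μ, (K μ)ᴴ * Y * K μ) * CFC.sqrt σ)ᴴ := by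
      simp only [conjTranspose_mul, conjTranspose_sum, conjTranspose_conjTranspose,
        conjTranspose_sqrt, Matrix.mul_sum, Matrix.mul_assoc]
    rw [e, conjTranspose_conjTranspose] at h
    refine h.trans_eq ?_
    calc _ = ∑ μ, (Y * (K μ * (CFC.sqrt σ * CFC.sqrt σ) * (K μ)ᴴ) * Yᴴ).trace := by
          rw [trace_sum]
          refine Finset.sum_congr rfl fun μ _ => ?_
          rw [trace_mul_comm]
          simp only [conjTranspose_mul, conjTranspose_conjTranspose, conjTranspose_sqrt,
            Matrix.mul_assoc]
      _ = (Y * (q * q) * Yᴴ).trace := by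
          rw [← trace_sum, hqq, sqrt_mul_sqrt hσ, Matrix.mul_sum, Matrix.sum_mul]
      _ = _ := by
          rw [trace_mul_comm _ (Y * q), conjTranspose_mul, hq.eq]; simp only [Matrix.mul_assoc]
  simpa only [conjTranspose_mul, conjTranspose_kronecker, conjTranspose_one, hq.transpose.eq,
    (sqrt_posSemidef σ).isHermitian.transpose.eq, Matrix.mul_assoc] using key

omit [DecidableEq n] [DecidableEq k] in
theorem sum_kraus_posSemidef (K : ι → Matrix k n ℂ) {ρ : Matrix n n ℂ} (hρ : ρ.PosSemidef) :
    (∑ μ, K μ * ρ * (K μ)ᴴ).PosSemidef :=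
  posSemidef_sum _ fun μ _ => hρ.mul_mul_conjTranspose_same (K μ)

/-- Monotonicity of the affinity under quantum channels. -/
theorem affinity_le_affinity_kraus (K : ι → Matrix k n ℂ) (hK : ∑ μ, (K μ)ᴴ * K μ = 1)
    {ρ σ : Matrix n n ℂ} (hρ : ρ.PosSemidef) (hσ : σ.PosSemidef) :
    affinity ρ σ ≤ affinity (∑ μ, K μ * ρ * (K μ)ᴴ) (∑ μ, K μ * σ * (K μ)ᴴ) := by
  set ρ' := ∑ μ, K μ * ρ * (K μ)ᴴ with hρ'
  set σ' := ∑ μ, K μ * σ * (K μ)ᴴ with hσ'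
  have sq_ρ' := sqrt_mul_sqrt (A := ρ') (sum_kraus_posSemidef K hρ)
  have sq_σ' := sqrt_mul_sqrt (A := σ') (sum_kraus_posSemidef K hσ)
  have hdual : dualChannel K *ᵥ vec (1 : Matrix k k ℂ) = vec (1 : Matrix n n ℂ) := by
    rw [dualChannel_mulVec_vec]
    simp only [Matrix.mul_one, hK]
  -- `compress_mul_le` inverts `p`, while `√ρ'` may be singular; the shift by `ε` costs `ε Tr √σ'`.
  have perturbed : ∀ ε : ℝ, 0 < ε →
      affinity ρ σ ≤ affinity ρ' σ' + ε * (CFC.sqrt σ').trace.re := by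
    intro ε hε
    set p : Matrix k k ℂ := CFC.sqrt ρ' + (ε : ℂ) • 1 with hp
    have hε1 : ((ε : ℂ) • (1 : Matrix k k ℂ)).PosDef :=
      PosDef.one.smul (by exact_mod_cast hε)
    have hpd : p.PosDef := hε1.posSemidef_add (sqrt_posSemidef ρ')
    have hle : ((1 : Matrix k k ℂ) ⊗ₖ CFC.sqrt ρ') * (1 ⊗ₖ CFC.sqrt ρ') ≤ (1 ⊗ₖ p) * (1 ⊗ₖ p) := by
      rw [← mul_kronecker_mul, ← mul_kronecker_mul, le_iff]
      have h1 : ((2 * ε : ℂ) • CFC.sqrt ρ' + (ε * ε : ℂ) • (1 : Matrix k k ℂ)).PosSemidef :=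
        ((sqrt_posSemidef ρ').smul (by exact_mod_cast (by positivity : 0 ≤ 2 * ε))).add
          (PosSemidef.one.smul (by exact_mod_cast (by positivity : 0 ≤ ε * ε)))
      have h2 := (PosSemidef.one (n := k) (R := ℂ)).kronecker h1
      convert h2 using 1
      have e : p * p = CFC.sqrt ρ' * CFC.sqrt ρ' +
          ((2 * ε : ℂ) • CFC.sqrt ρ' + (ε * ε : ℂ) • (1 : Matrix k k ℂ)) := by
        simp only [hp, Matrix.add_mul, Matrix.mul_add, Matrix.mul_smul, Matrix.smul_mul,
          Matrix.mul_one, Matrix.one_mul]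
        module
      rw [Matrix.one_mul, e, kronecker_add, add_sub_cancel_left]
    have h := compress_mul_le (dualChannel K)
      (r := (1 : Matrix n n ℂ) ⊗ₖ CFC.sqrt ρ) (s := (CFC.sqrt σ)ᵀ ⊗ₖ (1 : Matrix n n ℂ))
      (p := (1 : Matrix k k ℂ) ⊗ₖ p) (q := (CFC.sqrt σ')ᵀ ⊗ₖ (1 : Matrix k k ℂ))
      (PosSemidef.one.kronecker (sqrt_posSemidef ρ)).isHermitian
      ((sqrt_posSemidef σ).transpose.kronecker PosSemidef.one).isHermitian
      (by
        rw [← mul_kronecker_mul, Matrix.one_mul, Matrix.mul_one]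
        exact (sqrt_posSemidef σ).transpose.kronecker (sqrt_posSemidef ρ))
      (PosDef.one.kronecker hpd)
      ((sqrt_posSemidef σ').transpose.kronecker PosSemidef.one).isHermitian
      (by
        rw [← mul_kronecker_mul, Matrix.one_mul, Matrix.mul_one]
        exact (sqrt_posSemidef σ').transpose.kronecker hpd.posSemidef)
      ((dualChannel_left_le K hK hρ (sqrt_posSemidef ρ').isHermitian sq_ρ').trans hle)
      (dualChannel_right_le K hK hσ (sqrt_posSemidef σ').isHermitian sq_σ')
    -- The dual channel fixes the identity, so this quadratic form turns the operator inequality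
    -- into one between traces.
    have h1 := (le_iff.1 h).dotProduct_mulVec_nonneg (vec (1 : Matrix k k ℂ))
    rw [sub_mulVec, dotProduct_sub, sub_nonneg, ← mulVec_mulVec, ← mulVec_mulVec,
      dotProduct_mulVec _ (dualChannel K)ᴴ, ← star_mulVec, hdual, ← mul_kronecker_mul,
      ← mul_kronecker_mul, kronecker_mulVec_vec, kronecker_mulVec_vec, star_vec_dotProduct_vec,
      star_vec_dotProduct_vec] at h1
    simp only [conjTranspose_one, Matrix.one_mul, Matrix.mul_one, transpose_transpose, hp,
      Matrix.add_mul, Matrix.smul_mul, trace_add, trace_smul] at h1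
    have := (Complex.le_def.1 h1).1
    simpa [affinity] using this
  refine le_of_forall_pos_le_add fun δ hδ => ?_
  set t := (CFC.sqrt σ').trace.re
  have ht : 0 ≤ t := (Complex.le_def.1 (sqrt_posSemidef σ').trace_nonneg).1
  -- The denominator is `t + 1` because `t` may vanish.
  refine (perturbed (δ / (t + 1)) (by positivity)).trans ?_
  gcongr
  rw [div_mul_eq_mul_div, div_le_iff₀ (by positivity)]
  nlinarith

end Affinity

/-! ### Joint concavity and selective monotonicity -/

section AffinityProperties

variable {n k ι : Type*} [Fintype n] [DecidableEq n] [Fintype k] [DecidableEq k] [Fintype ι]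
  [DecidableEq ι]

theorem affinity_self {ρ : Matrix n n ℂ} (hρ : ρ.PosSemidef) : affinity ρ ρ = ρ.trace.re := by
  rw [affinity, sqrt_mul_sqrt hρ]

theorem affinity_zero_left (σ : Matrix n n ℂ) : affinity 0 σ = 0 := by
  simp [affinity, CFC.sqrt_zero]

theorem sqrt_smul {c : ℝ} (hc : 0 ≤ c) {ρ : Matrix n n ℂ} (hρ : ρ.PosSemidef) :
    CFC.sqrt ((c : ℂ) • ρ) = (Real.sqrt c : ℂ) • CFC.sqrt ρ := by
  refine sqrt_eq_of_mul_self ?_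
    ((sqrt_posSemidef ρ).smul (by exact_mod_cast Real.sqrt_nonneg c))
  rw [Matrix.smul_mul, Matrix.mul_smul, smul_smul, sqrt_mul_sqrt hρ, ← Complex.ofReal_mul,
    Real.mul_self_sqrt hc]

theorem affinity_smul {c : ℝ} (hc : 0 ≤ c) {ρ σ : Matrix n n ℂ} (hρ : ρ.PosSemidef)
    (hσ : σ.PosSemidef) : affinity ((c : ℂ) • ρ) ((c : ℂ) • σ) = c * affinity ρ σ := by
  rw [affinity, sqrt_smul hc hρ, sqrt_smul hc hσ, Matrix.smul_mul, Matrix.mul_smul, smul_smul,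
    ← Complex.ofReal_mul, Real.mul_self_sqrt hc, trace_smul, smul_eq_mul, Complex.re_ofReal_mul,
    affinity]

theorem blockDiagonal_posSemidef {A : ι → Matrix n n ℂ} (hA : ∀ i, (A i).PosSemidef) :
    (blockDiagonal A).PosSemidef := by
  have h := posSemidef_conjTranspose_mul_self (blockDiagonal fun i => CFC.sqrt (A i))
  rw [blockDiagonal_conjTranspose, ← blockDiagonal_mul] at h
  simpa only [conjTranspose_sqrt, sqrt_mul_sqrt (hA _)] using h

theorem sqrt_blockDiagonal {A : ι → Matrix n n ℂ} (hA : ∀ i, (A i).PosSemidef) :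
    CFC.sqrt (blockDiagonal A) = blockDiagonal fun i => CFC.sqrt (A i) := by
  refine sqrt_eq_of_mul_self ?_ (blockDiagonal_posSemidef fun i => sqrt_posSemidef _)
  rw [← blockDiagonal_mul]
  simp only [sqrt_mul_sqrt (hA _)]

theorem affinity_blockDiagonal {A B : ι → Matrix n n ℂ} (hA : ∀ i, (A i).PosSemidef)
    (hB : ∀ i, (B i).PosSemidef) :
    affinity (blockDiagonal A) (blockDiagonal B) = ∑ i, affinity (A i) (B i) := by
  rw [affinity, sqrt_blockDiagonal hA, sqrt_blockDiagonal hB, ← blockDiagonal_mul,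
    trace_blockDiagonal, Complex.re_sum]
  rfl

/-- The coordinate projection of `ℂⁿ ⊗ ℂ^ι` onto the copy of `ℂⁿ` with index `i`. -/
def blockProj (n : Type*) [DecidableEq n] (i : ι) : Matrix n (n × ι) ℂ :=
  (1 : Matrix (n × ι) (n × ι) ℂ).submatrix (fun j => (j, i)) id

theorem blockProj_mul_mul_conjTranspose (i : ι) (X : Matrix (n × ι) (n × ι) ℂ) :
    blockProj n i * X * (blockProj n i)ᴴ = X.submatrix (fun j => (j, i)) (fun j => (j, i)) := by
  ext a b
  simp [blockProj, Matrix.mul_apply, Matrix.one_apply]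

theorem blockProj_mul_conjTranspose_self (i : ι) :
    blockProj n i * (blockProj n i)ᴴ = 1 := by
  ext a b
  simp [blockProj, Matrix.mul_apply, Matrix.one_apply, eq_comm]

theorem sum_conjTranspose_blockProj_mul (A : ι → Matrix n n ℂ) :
    ∑ i, (blockProj n i)ᴴ * A i * blockProj n i = blockDiagonal A := by
  ext ⟨a, i⟩ ⟨b, j⟩
  simp [blockProj, Matrix.sum_apply, Matrix.mul_apply, Matrix.one_apply, blockDiagonal_apply,
    Prod.ext_iff, ite_and, eq_comm]
  split_ifs with h
  · rw [h]
  · rfl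

theorem sum_conjTranspose_blockProj_mul_self :
    ∑ i : ι, (blockProj n i)ᴴ * blockProj n i = 1 := by
  have := sum_conjTranspose_blockProj_mul (n := n) (ι := ι) fun _ => 1
  simp only [Matrix.mul_one] at this
  rw [this]
  exact blockDiagonal_one

/-- Joint concavity of the affinity. -/
theorem sum_affinity_le_affinity_sum {A B : ι → Matrix n n ℂ} (hA : ∀ i, (A i).PosSemidef)
    (hB : ∀ i, (B i).PosSemidef) :
    ∑ i, affinity (A i) (B i) ≤ affinity (∑ i, A i) (∑ i, B i) := by
  -- This channel is the partial trace over the block index: it adds up the diagonal blocks.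
  have h := affinity_le_affinity_kraus (fun i : ι => blockProj n i)
    sum_conjTranspose_blockProj_mul_self (blockDiagonal_posSemidef hA) (blockDiagonal_posSemidef hB)
  have e : ∀ (A : ι → Matrix n n ℂ) i, blockProj n i * blockDiagonal A * (blockProj n i)ᴴ = A i := by
    intro A i
    rw [blockProj_mul_mul_conjTranspose]
    ext a b
    simp [blockDiagonal_apply]
  rw [affinity_blockDiagonal hA hB] at h
  simpa only [e] using h

/-- Monotonicity of the affinity under selective operations. -/
theorem affinity_le_sum_affinity_kraus (K : ι → Matrix k n ℂ) (hK : ∑ μ, (K μ)ᴴ * K μ = 1)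
    {ρ σ : Matrix n n ℂ} (hρ : ρ.PosSemidef) (hσ : σ.PosSemidef) :
    affinity ρ σ ≤ ∑ μ, affinity (K μ * ρ * (K μ)ᴴ) (K μ * σ * (K μ)ᴴ) := by
  -- The outcome `μ` is recorded in an orthogonal block, so the output is block diagonal and its
  -- affinity splits as a sum.
  have h := affinity_le_affinity_kraus (fun μ => (blockProj k μ)ᴴ * K μ) (by
    rw [← hK]
    refine Finset.sum_congr rfl fun μ _ => ?_
    calc _ = (K μ)ᴴ * (blockProj k μ * (blockProj k μ)ᴴ) * K μ := by
          simp only [conjTranspose_mul, conjTranspose_conjTranspose, Matrix.mul_assoc]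
      _ = _ := by rw [blockProj_mul_conjTranspose_self, Matrix.mul_one]) hρ hσ
  have e : ∀ ρ : Matrix n n ℂ, ∑ μ, (blockProj k μ)ᴴ * K μ * ρ * ((blockProj k μ)ᴴ * K μ)ᴴ =
      blockDiagonal fun μ => K μ * ρ * (K μ)ᴴ := by
    intro ρ
    rw [← sum_conjTranspose_blockProj_mul]
    simp only [conjTranspose_mul, conjTranspose_conjTranspose, Matrix.mul_assoc]
  rwa [e, e, affinity_blockDiagonal (fun μ => hρ.mul_mul_conjTranspose_same _)
    (fun μ => hσ.mul_mul_conjTranspose_same _)] at h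

end AffinityProperties

/-! ### The antiunitary `𝒫𝒯` and its conjugation action on matrices -/

namespace PTPair

variable {n : Type*} [Fintype n] [DecidableEq n] (M : PTPair n)

/-- The unitary matrix `W` with `𝒫𝒯 = W𝒦`. -/
def W : Matrix n n ℂ := M.P * M.U

omit [DecidableEq n] in
theorem _root_.PTAsymmetry.star_mulVec_eq (X : Matrix n n ℂ) (v : n → ℂ) :
    star (X *ᵥ v) = X.map (starRingEnd ℂ) *ᵥ star v := by
  ext i
  simp [mulVec, dotProduct]

theorem unitaryConj_apply (U : Matrix n n ℂ) (v : n → ℂ) : unitaryConj U v = U *ᵥ star v := rfl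

theorem PT_apply (v : n → ℂ) : M.PT v = M.W *ᵥ star v := by
  rw [W, ← mulVec_mulVec]
  rfl

theorem P_mul_U : M.P * M.U = M.U * M.P.map (starRingEnd ℂ) := by
  refine ext_of_mulVec_single fun i => ?_
  have h := LinearMap.congr_fun M.comm (star (Pi.single i 1))
  simp only [LinearMap.comp_apply, unitaryConj_apply, toLin'_apply, star_mulVec_eq,
    star_star] at h
  rwa [mulVec_mulVec, mulVec_mulVec] at h

/-- This is `(𝒫𝒯)² = 1`: symmetry of `U` gives `𝒯² = 1`, and `𝒫` commutes with `𝒯`. -/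
theorem W_mul_map_conj : M.W * M.W.map (starRingEnd ℂ) = 1 := by
  have hU : M.U.map (starRingEnd ℂ) = M.Uᴴ := by
    conv_lhs => rw [← M.U_symm]
    rfl
  have hUU : M.U * M.Uᴴ = 1 := mem_unitaryGroup_iff.1 M.U_unitary
  calc M.W * M.W.map (starRingEnd ℂ)
      = M.P * (M.U * M.P.map (starRingEnd ℂ)) * M.U.map (starRingEnd ℂ) := by
        rw [W, Matrix.map_mul]; simp only [Matrix.mul_assoc]
    _ = (M.P * M.P) * (M.U * M.Uᴴ) := by
        rw [← P_mul_U, hU]; simp only [Matrix.mul_assoc]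
    _ = 1 := by rw [M.P_sq, hUU, Matrix.mul_one]

theorem conjTranspose_W_mul : M.Wᴴ * M.W = 1 := by
  have hUU : M.Uᴴ * M.U = 1 := mem_unitaryGroup_iff'.1 M.U_unitary
  calc M.Wᴴ * M.W = M.Uᴴ * (M.P * M.P) * M.U := by
        rw [W, conjTranspose_mul, M.P_isHermitian.eq]; simp only [Matrix.mul_assoc]
    _ = 1 := by rw [M.P_sq, Matrix.mul_one, hUU]

theorem map_conj_W : M.W.map (starRingEnd ℂ) = M.Wᴴ := by
  calc _ = M.Wᴴ * M.W * M.W.map (starRingEnd ℂ) := by rw [conjTranspose_W_mul, Matrix.one_mul]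
    _ = _ := by rw [Matrix.mul_assoc, W_mul_map_conj, Matrix.mul_one]

theorem W_mul_conjTranspose : M.W * M.Wᴴ = 1 := by
  rw [← map_conj_W, W_mul_map_conj]

omit [Fintype n] [DecidableEq n] in
theorem map_conj_map_conj (X : Matrix n n ℂ) :
    (X.map (starRingEnd ℂ)).map (starRingEnd ℂ) = X := by
  ext; simp

theorem conjugate_eq (X : Matrix n n ℂ) :
    M.conjugate X = M.W * X.map (starRingEnd ℂ) * M.Wᴴ := by
  refine ext_of_mulVec_single fun i => ?_
  rw [conjugate, LinearMap.toMatrix'_mulVec]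
  simp only [LinearMap.comp_apply, PT_apply, toLin'_apply, star_mulVec_eq, star_star,
    mulVec_mulVec, Matrix.map_mul, map_conj_W, Matrix.mul_assoc]

theorem conjugate_mul (X Y : Matrix n n ℂ) :
    M.conjugate (X * Y) = M.conjugate X * M.conjugate Y := by
  simp only [conjugate_eq, Matrix.map_mul]
  calc _ = M.W * X.map (starRingEnd ℂ) * 1 * (Y.map (starRingEnd ℂ) * M.Wᴴ) := by
        simp only [Matrix.mul_one, Matrix.mul_assoc]
    _ = _ := by rw [← M.conjTranspose_W_mul]; simp only [Matrix.mul_assoc]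

theorem conjugate_smul (c : ℝ) (X : Matrix n n ℂ) :
    M.conjugate ((c : ℂ) • X) = (c : ℂ) • M.conjugate X := by
  have : ((c : ℂ) • X).map (starRingEnd ℂ) = (c : ℂ) • X.map (starRingEnd ℂ) := by
    ext; simp
  rw [conjugate_eq, conjugate_eq, this, Matrix.mul_smul, Matrix.smul_mul]

theorem conjugate_sum {ι : Type*} [Fintype ι] (X : ι → Matrix n n ℂ) :
    M.conjugate (∑ i, X i) = ∑ i, M.conjugate (X i) := by
  have : (∑ i, X i).map (starRingEnd ℂ) = ∑ i, (X i).map (starRingEnd ℂ) := by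
    ext; simp [Matrix.sum_apply]
  simp only [conjugate_eq, this, Matrix.mul_sum, Matrix.sum_mul]

theorem conjugate_posSemidef {X : Matrix n n ℂ} (hX : X.PosSemidef) :
    (M.conjugate X).PosSemidef := by
  rw [conjugate_eq]
  exact hX.conjTranspose.transpose.mul_mul_conjTranspose_same _

theorem trace_conjugate (X : Matrix n n ℂ) : (M.conjugate X).trace = conj X.trace := by
  rw [conjugate_eq, trace_mul_comm, ← Matrix.mul_assoc, conjTranspose_W_mul, Matrix.one_mul]
  simp [trace]

theorem sqrt_conjugate {ρ : Matrix n n ℂ} (hρ : ρ.PosSemidef) :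
    CFC.sqrt (M.conjugate ρ) = M.conjugate (CFC.sqrt ρ) :=
  sqrt_eq_of_mul_self (by rw [← conjugate_mul, sqrt_mul_sqrt hρ])
    (M.conjugate_posSemidef (sqrt_posSemidef ρ))

theorem commutator_apply (X : Matrix n n ℂ) (v : n → ℂ) :
    M.commutator X v = (X * M.W - M.W * X.map (starRingEnd ℂ)) *ᵥ star v := by
  simp only [commutator, LinearMap.sub_apply, LinearMap.comp_apply, PT_apply, toLin'_apply,
    star_mulVec_eq, mulVec_mulVec, sub_mulVec]

theorem commutator_eq_zero_iff (X : Matrix n n ℂ) :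
    M.commutator X = 0 ↔ M.conjugate X = X := by
  rw [conjugate_eq]
  constructor
  · intro h
    have h1 : X * M.W = M.W * X.map (starRingEnd ℂ) := by
      rw [← sub_eq_zero]
      refine ext_of_mulVec_single fun i => ?_
      have := LinearMap.congr_fun h (star (Pi.single i 1))
      rw [commutator_apply, star_star] at this
      rw [this, LinearMap.zero_apply, zero_mulVec]
    rw [← h1, Matrix.mul_assoc, W_mul_conjTranspose, Matrix.mul_one]
  · intro h
    refine LinearMap.ext fun v => ?_
    have h1 : X * M.W = M.W * X.map (starRingEnd ℂ) := by
      conv_lhs => rw [← h]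
      rw [Matrix.mul_assoc, conjTranspose_W_mul, Matrix.mul_one]
    rw [commutator_apply, h1, sub_self, zero_mulVec, LinearMap.zero_apply]

theorem commutatorSq_eq (X : Matrix n n ℂ) :
    M.commutatorSq X = X * M.conjugate X - X * X - M.conjugate (X * X) + M.conjugate X * X := by
  have h : M.commutatorSq X = (X * M.W - M.W * X.map (starRingEnd ℂ)) *
      (X * M.W - M.W * X.map (starRingEnd ℂ)).map (starRingEnd ℂ) := by
    refine ext_of_mulVec_single fun i => ?_
    rw [commutatorSq, LinearMap.toMatrix'_mulVec]
    simp only [LinearMap.comp_apply, commutator_apply, star_mulVec_eq, star_star, mulVec_mulVec]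
  have e : (X * M.W - M.W * X.map (starRingEnd ℂ)).map (starRingEnd ℂ) =
      X.map (starRingEnd ℂ) * M.Wᴴ - M.Wᴴ * X := by
    rw [Matrix.map_sub _ (map_sub _), Matrix.map_mul, Matrix.map_mul, map_conj_W,
      map_conj_map_conj]
  have hc : ∀ Z, M.W * (M.Wᴴ * Z) = Z := fun Z => by
    rw [← Matrix.mul_assoc, W_mul_conjTranspose, Matrix.one_mul]
  rw [h, e]
  simp only [conjugate_eq, Matrix.map_mul, Matrix.mul_sub, Matrix.sub_mul, Matrix.mul_assoc, hc]
  abel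

end PTPair

/-! ### The asymmetry measure -/

section Measure

variable {n : Type*} [Fintype n] [DecidableEq n] (M : PTPair n)

theorem gammaS_eq {ρ : Matrix n n ℂ} (hρ : ρ.PosSemidef) :
    gammaS M ρ = 1 - affinity ρ (M.conjugate ρ) := by
  rw [gammaS, affinity, M.sqrt_conjugate hρ]

/-- The trace of a product of two Hermitian matrices is real, so taking the real part in `gammaS`
loses nothing. -/
theorem ofReal_gammaS (ρ : Matrix n n ℂ) :
    (gammaS M ρ : ℂ) = 1 - (CFC.sqrt ρ * M.conjugate (CFC.sqrt ρ)).trace := by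
  set A := CFC.sqrt ρ
  have hA : Aᴴ = A := conjTranspose_sqrt ρ
  have hJ : (M.conjugate A)ᴴ = M.conjugate A :=
    (M.conjugate_posSemidef (sqrt_posSemidef ρ)).isHermitian
  have h : conj (A * M.conjugate A).trace = (A * M.conjugate A).trace := by
    rw [starRingEnd_apply, ← trace_conjTranspose, conjTranspose_mul, hA, hJ, trace_mul_comm]
  rw [gammaS, Complex.ofReal_sub, Complex.ofReal_one, Complex.conj_eq_iff_re.1 h]

theorem ofReal_gammaS_eq_trace_commutatorSq {ρ : Matrix n n ℂ} (hρ : IsState ρ) :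
    (gammaS M ρ : ℂ) = -(1 / 2) * (M.commutatorSq (CFC.sqrt ρ)).trace := by
  rw [ofReal_gammaS, M.commutatorSq_eq, trace_add, trace_sub, trace_sub, sqrt_mul_sqrt hρ.1,
    M.trace_conjugate, hρ.2, trace_mul_comm (M.conjugate _), map_one]
  ring

theorem gammaS_eq_zero_iff {ρ : Matrix n n ℂ} (hρ : IsState ρ) :
    gammaS M ρ = 0 ↔ M.commutator ρ = 0 := by
  rw [M.commutator_eq_zero_iff]
  constructor
  · intro h
    set A := CFC.sqrt ρ with hAdef
    have hA : Aᴴ = A := conjTranspose_sqrt ρ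
    have hAA : A * A = ρ := sqrt_mul_sqrt hρ.1
    have hJ : (M.conjugate A)ᴴ = M.conjugate A :=
      (M.conjugate_posSemidef (sqrt_posSemidef ρ)).isHermitian
    have h1 : (A * M.conjugate A).trace = 1 := by
      have := ofReal_gammaS M ρ
      rw [h, Complex.ofReal_zero] at this
      exact (sub_eq_zero.1 this.symm).symm
    -- `‖A - JA‖² = Tr ρ + Tr Jρ - 2 Tr (A JA) = 1 + 1 - 2`.
    have h2 : ((A - M.conjugate A)ᴴ * (A - M.conjugate A)).trace = 0 := by
      rw [conjTranspose_sub, hA, hJ, Matrix.sub_mul, Matrix.mul_sub, Matrix.mul_sub, trace_sub,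
        trace_sub, trace_sub, trace_mul_comm (M.conjugate A) A, h1, ← M.conjugate_mul, hAA,
        M.trace_conjugate, hρ.2, map_one]
      ring
    have h3 : A = M.conjugate A := sub_eq_zero.1 (trace_conjTranspose_mul_self_eq_zero_iff.1 h2)
    rw [← hAA, M.conjugate_mul, ← h3]
  · intro h
    rw [gammaS_eq M hρ.1, h, affinity_self hρ.1, hρ.2, Complex.one_re, sub_self]

theorem outcomeProb_mul_gammaS_outcomeState (K : Matrix n n ℂ) {ρ : Matrix n n ℂ}
    (hρ : ρ.PosSemidef) :
    outcomeProb K ρ * gammaS M (outcomeState K ρ) =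
      outcomeProb K ρ - affinity (K * ρ * Kᴴ) (M.conjugate (K * ρ * Kᴴ)) := by
  have hX := hρ.mul_mul_conjTranspose_same K
  have htr := Complex.le_def.1 hX.trace_nonneg
  have hp : 0 ≤ outcomeProb K ρ := htr.1
  rcases hp.eq_or_lt with h0 | h0
  · have : K * ρ * Kᴴ = 0 := hX.trace_eq_zero_iff.1 (Complex.ext h0.symm htr.2.symm)
    rw [← h0, this, affinity_zero_left]
    simp
  · have hinv : 0 ≤ (outcomeProb K ρ)⁻¹ := inv_nonneg.2 hp
    rw [outcomeState, ← Complex.ofReal_inv,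
      gammaS_eq M (hX.smul (by exact_mod_cast hinv)), M.conjugate_smul,
      affinity_smul hinv hX (M.conjugate_posSemidef hX)]
    field_simp

theorem sum_outcomeProb {m : ℕ} {K : Fin m → Matrix n n ℂ} (hK : IsKraus K) {ρ : Matrix n n ℂ}
    (hρ : IsState ρ) : ∑ μ, outcomeProb (K μ) ρ = 1 := by
  have : ∑ μ, (K μ * ρ * (K μ)ᴴ).trace = 1 := by
    have h : ∀ μ, (K μ * ρ * (K μ)ᴴ).trace = ((K μ)ᴴ * K μ * ρ).trace := fun μ => by
      rw [trace_mul_comm, Matrix.mul_assoc]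
    rw [Finset.sum_congr rfl fun μ _ => h μ, ← trace_sum, ← Matrix.sum_mul, hK, Matrix.one_mul,
      hρ.2]
  simp only [outcomeProb, ← Complex.re_sum, this, Complex.one_re]

theorem gammaS_isProperMeasure : IsProperMeasure M (gammaS M) where
  faithful _ hρ := gammaS_eq_zero_iff M hρ
  monotone := by
    rintro Φ ⟨m, K, hK, hΦ⟩ hcov ρ hρ
    have hpos : (Φ ρ).PosSemidef := by rw [hΦ]; exact sum_kraus_posSemidef K hρ.1
    -- Covariance makes both arguments of the affinity outputs of the same channel.
    rw [gammaS_eq M hρ.1, gammaS_eq M hpos, ← hcov ρ hρ, hΦ, hΦ]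
    exact sub_le_sub_left
      (affinity_le_affinity_kraus K hK hρ.1 (M.conjugate_posSemidef hρ.1)) 1
  selective_monotone := by
    intro m K hK hcov ρ hρ
    have h : ∀ μ, K μ * M.conjugate ρ * (K μ)ᴴ = M.conjugate (K μ * ρ * (K μ)ᴴ) :=
      fun μ => hcov μ ρ hρ
    simp only [outcomeProb_mul_gammaS_outcomeState M _ hρ.1, Finset.sum_sub_distrib,
      sum_outcomeProb hK hρ, ← h]
    rw [gammaS_eq M hρ.1]
    exact sub_le_sub_left
      (affinity_le_sum_affinity_kraus K hK hρ.1 (M.conjugate_posSemidef hρ.1)) 1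
  convex := by
    intro m p ρ hp hsum hρ
    have hpos : ∀ k, ((p k : ℂ) • ρ k).PosSemidef := fun k =>
      (hρ k).1.smul (by exact_mod_cast hp k)
    rw [gammaS_eq M (posSemidef_sum _ fun k _ => hpos k), M.conjugate_sum]
    have h := sum_affinity_le_affinity_sum hpos fun k => M.conjugate_posSemidef (hpos k)
    -- The affinity is homogeneous of degree one, so the weights can be absorbed into the states.
    have e : ∀ k, p k * gammaS M (ρ k) =
        p k - affinity ((p k : ℂ) • ρ k) (M.conjugate ((p k : ℂ) • ρ k)) := fun k => by
      rw [M.conjugate_smul, affinity_smul (hp k) (hρ k).1 (M.conjugate_posSemidef (hρ k).1),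
        gammaS_eq M (hρ k).1]
      ring
    rw [Finset.sum_congr rfl fun k _ => e k, Finset.sum_sub_distrib, hsum]
    exact sub_le_sub_left h 1

theorem affinity_le_fidelity (ρ σ : Matrix n n ℂ) : affinity ρ σ ≤ fidelity ρ σ :=
  re_trace_le_trace_abs _

theorem gammaF_le_gammaS {ρ : Matrix n n ℂ} (hρ : ρ.PosSemidef) : gammaF M ρ ≤ gammaS M ρ := by
  rw [gammaS_eq M hρ, gammaF]
  refine sub_le_sub_left ?_ 1
  -- The factors stand in this order so that `QᴴQ = √ρ Jρ √ρ`.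
  have h := re_trace_le_trace_abs (CFC.sqrt (M.conjugate ρ) * CFC.sqrt ρ)
  rw [trace_mul_comm, conjTranspose_mul, conjTranspose_sqrt, conjTranspose_sqrt] at h
  refine h.trans_eq ?_
  congr 3
  conv_rhs => rw [← sqrt_mul_sqrt (M.conjugate_posSemidef hρ)]
  simp only [Matrix.mul_assoc]

end Measure

end PTAsymmetry

end

theorem proposition3 {n : Type*} [Fintype n] [DecidableEq n] (M : PTAsymmetry.PTPair n) :
    (∀ ρ : Matrix n n ℂ, PTAsymmetry.IsState ρ →
      (PTAsymmetry.gammaS M ρ : ℂ)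
          = -(1 / 2) * (M.commutatorSq (CFC.sqrt ρ)).trace ∧
      (PTAsymmetry.gammaS M ρ : ℂ)
          = 1 - (CFC.sqrt ρ * M.conjugate (CFC.sqrt ρ)).trace) ∧
    PTAsymmetry.IsProperMeasure M (PTAsymmetry.gammaS M) ∧
    (∀ ρ : Matrix n n ℂ, PTAsymmetry.IsState ρ →
      1 - PTAsymmetry.fidelity ρ (M.conjugate ρ) ≤ PTAsymmetry.gammaS M ρ ∧
      PTAsymmetry.gammaF M ρ ≤ PTAsymmetry.gammaS M ρ) := by
  refine ⟨fun ρ hρ => ⟨PTAsymmetry.ofReal_gammaS_eq_trace_commutatorSq M hρ,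
    PTAsymmetry.ofReal_gammaS M ρ⟩, PTAsymmetry.gammaS_isProperMeasure M, fun ρ hρ => ⟨?_,
    PTAsymmetry.gammaF_le_gammaS M hρ.1⟩⟩
  rw [PTAsymmetry.gammaS_eq M hρ.1]
  exact sub_le_sub_left (PTAsymmetry.affinity_le_fidelity _ _) 1
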